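/- Let $\mathbb{F}_q$ be a finite field, $q=p^r$ with $p$ prime, with a fixed primitive element $\alpha$ and a fixed $\mathbb{F}_p$-basis $B=\{b_1,\dots,b_r\}$, and let $\pi_l:\mathbb{F}_q\to\mathbb{F}_p$ be the $l$-th coordinate map with respect to $B$. Let $\mathcal{C}\subseteq\mathbb{F}_q^n$ be a linear code and $H=(h_{ij})\in\mathbb{F}_q^{m\times n}$ a matrix such that $c\in\mathcal{C}$ if and only if $cH^T=0$. Let $\mathbb{K}$ be any field and let $\mathbf{x}=(x_{js})$, $\mathbf{y}=(y_{js})$ $(1\le j\le n,\ 1\le s\le q-1)$ and $\mathbf{z}=(z_1,\dots,z_{mr})$ be variables. For $a\in\mathbb{F}_q^n$ let $\blacktriangle a\in\{0,1\}^{n(q-1)}$ have entry $1$ at position $(j,s)$ if $a_j=\alpha^s$ and $0$ otherwise. The generalized code ideal is $$I_+(\mathcal{C})=\langle \mathbf{x}^{\blacktriangle a}-\mathbf{x}^{\blacktriangle b}\mid a-b\in\mathcal{C}\rangle\subseteq\mathbb{K}[\mathbf{x}],$$ and $I_q\subseteq\mathbb{K}[\mathbf{x}]$ denotes the ideal generated,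 for $1\le j\le n$, by all $x_{ju}x_{jv}-x_{jw}$ with $\alpha^u+\alpha^v=\alpha^w$ and all $x_{ju}x_{jv}-1$ with $\alpha^u+\alpha^v=0$. Let $H_{+,e}\in\mathbb{F}_p^{mr\times n(q-1)}$ be the matrix whose entry in row $(i,l)$ and column $(j,s)$ is $\pi_l(\alpha^s h_{ij})$, let $\triangle H_{+,e}$ be any integer matrix reducing to $H_{+,e}$ modulo $p$, and let $$\Lambda(H_{+,e})_p=\begin{pmatrix}\triangle H_{+,e}&\mathbf{0}&pI_{mr}\\ I_{n(q-1)}&I_{n(q-1)}&\mathbf{0}\end{pmatrix}$$ be its $p$-Lawrence lifting. The toric ideal of an integer matrix $A$ is $I_A=\langle \mathbf{t}^u-\mathbf{t}^v\mid Au=Av\rangle$, with $u,v$ ranging over vectors of non-negative integers. Put $$I_{\Lambda(H_{+,e})}=\{g(\mathbf{x},\mathbf{y},\mathbf{1})\mid g\in I_{\Lambda(H_{+,e})_p}\}\subseteq\mathbb{K}[\mathbf{x},\mathbf{y}],$$ where $I_{\Lambda(H_{+,e})_p}\subseteq\mathbb{K}[\mathbf{x},\mathbf{y},\mathbf{z}]$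 is the toric ideal of $\Lambda(H_{+,e})_p$. A pure binomial is a difference $\mathbf{x}^u-\mathbf{x}^v$ of two distinct, relatively prime monomials. A pure binomial $\mathbf{x}^u-\mathbf{x}^v$ in an ideal $I$ is primitive if there is no other pure binomial $\mathbf{x}^{u'}-\mathbf{x}^{v'}$ in $I$ with $\mathbf{x}^{u'}\mid\mathbf{x}^u$ and $\mathbf{x}^{v'}\mid\mathbf{x}^v$. The Graver basis $\mathrm{Gr}(I)$ is the set of all primitive binomials in $I$. Let $\mathcal{G}$ be the reduced Gröbner basis of $I_{\Lambda(H_{+,e})}$ with respect to any monomial order, and let $$S=\{\mathbf{x}^u-\mathbf{x}^v\mid \mathbf{x}^u\mathbf{y}^v-\mathbf{x}^v\mathbf{y}^u\in\mathcal{G}\}.$$ Then the following hold. 1. If no coordinate vanishes identically on $\mathcal{C}$, that is, for every $j$ there is $c\in\mathcal{C}$ with $c_j\ne0$, then $\mathrm{Gr}(I_+(\mathcal{C}))=S\cup(-S)$. 2. For every code $\mathcal{C}$, $\mathrm{Gr}(I_+(\mathcal{C})+I_q)=S\cup(-S)$. 3. $S$ contains each primitive binomial in one sign only: if $f\in S$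 and $-f\in S$, then $-f=f$ (which is possible only in characteristic $2$). -/

import Mathlib

open MvPolynomial

noncomputable section

/-- The difference of monomials `x^u - x^v`. -/
def monoDiff (K : Type*) [Field K] {σ : Type*} (u v : σ →₀ ℕ) : MvPolynomial σ K :=
  monomial u 1 - monomial v 1

/-- The exponents `u, v` give a pure binomial `x^u - x^v`: the two monomials are distinct and
relatively prime. -/
def IsPurePair {σ : Type*} (u v : σ →₀ ℕ) : Prop :=
  u ≠ v ∧ Disjoint u.support v.support

/-- `x^u - x^v` is a primitive (pure) binomial of `I`: no other pure binomial `x^u' - x^v'` of `I`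
satisfies `x^u' ∣ x^u` and `x^v' ∣ x^v`. -/
def IsPrimitiveBinomial {K : Type*} [Field K] {σ : Type*} (I : Ideal (MvPolynomial σ K))
    (u v : σ →₀ ℕ) : Prop :=
  IsPurePair u v ∧ monoDiff K u v ∈ I ∧
    ∀ u' v' : σ →₀ ℕ, IsPurePair u' v' → monoDiff K u' v' ∈ I → u' ≤ u → v' ≤ v →
      u' = u ∧ v' = v

/-- The Graver basis of `I`: the set of all primitive binomials of `I`. -/
def graverBasis {K : Type*} [Field K] {σ : Type*} (I : Ideal (MvPolynomial σ K)) :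
    Set (MvPolynomial σ K) :=
  {f | ∃ u v : σ →₀ ℕ, IsPrimitiveBinomial I u v ∧ f = monoDiff K u v}

/-- `G` is the reduced Gröbner basis of `I` with respect to the monomial order `ord`. -/
structure IsReducedGroebnerBasis {K : Type*} [Field K] {σ : Type*} (ord : MonomialOrder σ)
    (I : Ideal (MvPolynomial σ K)) (G : Set (MvPolynomial σ K)) : Prop where
  finite : G.Finite
  subset : ∀ g ∈ G, g ∈ I
  span_leadingTerm :
    Ideal.span (ord.leadingTerm '' G) = Ideal.span (ord.leadingTerm '' (I : Set (MvPolynomial σ K)))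
  monic : ∀ g ∈ G, ord.Monic g
  reduced : ∀ g ∈ G, ∀ h ∈ G, h ≠ g → ∀ d ∈ g.support, ¬ ord.degree h ≤ d

/-- The toric ideal `⟨x^u - x^v ∣ A u = A v⟩` of an integer matrix `A`. -/
def toricIdeal (K : Type*) [Field K] {ρ κ : Type*} [Fintype κ] (A : Matrix ρ κ ℤ) :
    Ideal (MvPolynomial κ K) :=
  Ideal.span {f | ∃ u v : κ →₀ ℕ,
    A.mulVec (fun i => (u i : ℤ)) = A.mulVec (fun i => (v i : ℤ)) ∧ f = monoDiff K u v}

/-- The `p`-Lawrence lifting, with rows `(D  0  p·1)` and `(1  1  0)`. -/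
def pLawrence {ρ ι : Type*} [DecidableEq ρ] [DecidableEq ι] (p : ℕ) (D : Matrix ρ ι ℤ) :
    Matrix (ρ ⊕ ι) ((ι ⊕ ι) ⊕ ρ) ℤ :=
  Matrix.fromBlocks (Matrix.fromCols D 0) ((p : ℤ) • (1 : Matrix ρ ρ ℤ)) (Matrix.fromCols 1 1) 0

/-- The substitution `z ↦ 1`, that is `g(x, y, z) ↦ g(x, y, 1)`. -/
def substOne (K : Type*) [Field K] (τ ρ : Type*) : MvPolynomial (τ ⊕ ρ) K →ₐ[K] MvPolynomial τ K :=
  aeval (Sum.elim X (fun _ => 1))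

/-- The ideal `{g(x, y, 1) ∣ g ∈ I}`, with `I` the toric ideal of the `p`-Lawrence lifting of `D`. -/
def lawrenceIdeal (K : Type*) [Field K] {ρ ι : Type*} [Fintype ρ] [Fintype ι] [DecidableEq ρ]
    [DecidableEq ι] (p : ℕ) (D : Matrix ρ ι ℤ) : Ideal (MvPolynomial (ι ⊕ ι) K) :=
  (toricIdeal K (pLawrence p D)).map (substOne K (ι ⊕ ι) ρ)

theorem mem_lawrenceIdeal_iff (K : Type*) [Field K] {ρ ι : Type*} [Fintype ρ] [Fintype ι]
    [DecidableEq ρ] [DecidableEq ι] (p : ℕ) (D : Matrix ρ ι ℤ) (f : MvPolynomial (ι ⊕ ι) K) :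
    f ∈ lawrenceIdeal K p D ↔
      ∃ g ∈ toricIdeal K (pLawrence p D), substOne K (ι ⊕ ι) ρ g = f := by
  refine Ideal.mem_map_iff_of_surjective _ fun f => ⟨rename Sum.inl f, ?_⟩
  have h : (Sum.elim X (fun _ => 1) : (ι ⊕ ι) ⊕ ρ → MvPolynomial (ι ⊕ ι) K) ∘ Sum.inl = X := by
    funext i
    rfl
  change aeval _ (rename Sum.inl f) = f
  rw [aeval_rename, h, aeval_X_left_apply]

/-- The binomial `x^u y^v - x^v y^u`. -/
def crossBinomial (K : Type*) [Field K] {ι : Type*} (u v : ι →₀ ℕ) : MvPolynomial (ι ⊕ ι) K :=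
  monoDiff K (Finsupp.sumElim u v) (Finsupp.sumElim v u)

/-- The set `{x^u - x^v ∣ x^u y^v - x^v y^u ∈ G}`. -/
def uncross {K : Type*} [Field K] {ι : Type*} (G : Set (MvPolynomial (ι ⊕ ι) K)) :
    Set (MvPolynomial ι K) :=
  {f | ∃ u v : ι →₀ ℕ, crossBinomial K u v ∈ G ∧ f = monoDiff K u v}

/-- The crossing map: the block at position `j` is the unit vector `e_s` if `a j = α ^ s`, with
`1 ≤ s ≤ q - 1`, and zero if `a j = 0`. The index `s : Fin (q - 1)` stands for the exponent
`s + 1`. -/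
def crossing {F : Type*} [Field F] {n q : ℕ} (α : F) (a : Fin n → F) : Fin n × Fin (q - 1) →₀ ℕ :=
  open Classical in
  Finsupp.equivFunOnFinite.symm fun i => if a i.1 = α ^ (i.2.val + 1) then 1 else 0

/-- The generalized code ideal `⟨x^(▲a) - x^(▲b) ∣ a - b ∈ C⟩`. -/
def genCodeIdeal (K : Type*) [Field K] {F : Type*} [Field F] {n : ℕ} (q : ℕ) (α : F)
    (C : Submodule F (Fin n → F)) : Ideal (MvPolynomial (Fin n × Fin (q - 1)) K) :=
  Ideal.span {f | ∃ a b : Fin n → F, a - b ∈ C ∧ f = monoDiff K (crossing α a) (crossing α b)}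

/-- The ideal encoding the additive structure of the field, generated by the
`x_{ju} x_{jv} - x_{jw}` with `α ^ u + α ^ v = α ^ w` and the `x_{ju} x_{jv} - 1` with
`α ^ u + α ^ v = 0`. -/
def additiveIdeal (K : Type*) [Field K] {F : Type*} [Field F] (n q : ℕ) (α : F) :
    Ideal (MvPolynomial (Fin n × Fin (q - 1)) K) :=
  Ideal.span
    ({f | ∃ (j : Fin n) (u v w : Fin (q - 1)),
        α ^ (u.val + 1) + α ^ (v.val + 1) = α ^ (w.val + 1) ∧
          f = X (j, u) * X (j, v) - X (j, w)} ∪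
      {f | ∃ (j : Fin n) (u v : Fin (q - 1)),
        α ^ (u.val + 1) + α ^ (v.val + 1) = 0 ∧ f = X (j, u) * X (j, v) - 1})

/-- The extended matrix `H_{+,e}`: the entry in row `(i, l)` and column `(j, s)` is the `l`-th
coordinate, in the basis `B`, of `α ^ s * H i j` (with `1 ≤ s ≤ q - 1`). -/
def extendedMatrix {p r n m : ℕ} {F : Type*} [Field F] [Algebra (ZMod p) F] (q : ℕ) (α : F)
    (B : Module.Basis (Fin r) (ZMod p) F) (H : Matrix (Fin m) (Fin n) F) :
    Matrix (Fin m × Fin r) (Fin n × Fin (q - 1)) (ZMod p) :=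
  Matrix.of fun i j => B.repr (α ^ (j.2.val + 1) * H i.1 j.1) i.2

end

/-!
All ideals involved are of one kind: give each variable a weight in a commutative monoid `A`; the
polynomials whose coefficients sum to zero over each weight form an ideal, and a difference of two
monomials lies in it exactly if the two have equal weight (`IsWeightIdeal`).

For `I_+(C) + I_q` the weight of `x_{js}` is the class modulo `C` of the word with entry `α ^ s` at
position `j`. Indeed the relations `I_q` make each monomial congruent to the crossed form of the
word it represents (`monoDiff_crossing_mem`), and crossed words are identified exactly when they
differ by a codeword (`isWeightIdeal_sup`). If no coordinate of `C` vanishes identically, the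
relations `I_q` already follow from `I_+(C)` (`additiveIdeal_le_genCodeIdeal`), so the two ideals
coincide. For the ideal of the `p`-Lawrence lifting, `x^a y^b` has as weight the pair formed by
`D a` modulo `p` and `a + b` (`isWeightIdeal_lawrenceIdeal`); the variables `z`, set to one, only
absorb multiples of `p`. The matrix `D` modulo `p` computes the syndrome in coordinates, so
`x^u - x^v` is in the code ideal exactly if `x^u y^v - x^v y^u` is in the Lawrence ideal.

What remains is the Lawrence argument. If `x^u - x^v` is primitive, then a divisor of
`x^u y^v` shares its Lawrence weight with another monomial only if it is `x^u y^v` itself, and that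
other monomial is `x^v y^u` (`IsPrimitiveBinomial.eq_of_lawrenceWeight_eq`). A basis element
whose leading monomial divides `x^u y^v` therefore contains both monomials, and by reducedness it
equals the binomial.
Conversely, if `x^u y^v - x^v y^u` is in the reduced Gröbner basis, then the leading monomial of any
smaller binomial of the same form divides a term of it, and reducedness forces equality
(`eq_of_crossBinomial_mem`). Finally a basis element is monic, which fixes the sign.
-/

noncomputable section

/-! ### Ideals graded by weights -/

section Weights

variable {K : Type*} [Field K] {σ A : Type*} [AddCommMonoid A]

/-- The homomorphism from the polynomial ring to the monoid algebra of `A` that sends each variable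
`X i` to the basis element of its weight `w i`; an exponent `u` has the weight
`Finsupp.linearCombination ℕ w u`. -/
def weightHom (K : Type*) [Field K] (w : σ → A) : MvPolynomial σ K →ₐ[K] AddMonoidAlgebra K A :=
  aeval fun i => AddMonoidAlgebra.single (w i) 1

theorem weightHom_monomial (w : σ → A) (u : σ →₀ ℕ) (c : K) :
    weightHom K w (monomial u c) =
      AddMonoidAlgebra.single (Finsupp.linearCombination ℕ w u) c := by
  have h : ∀ (i : σ) (k : ℕ), (AddMonoidAlgebra.single (w i) 1 : AddMonoidAlgebra K A) ^ k =
      AddMonoidAlgebra.single (k • w i) 1 := fun i k => by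
    rw [AddMonoidAlgebra.single_pow, one_pow]
  have h' : (u.prod fun i k => (AddMonoidAlgebra.single (w i) 1 : AddMonoidAlgebra K A) ^ k) =
      AddMonoidAlgebra.single (Finsupp.linearCombination ℕ w u) 1 := by
    induction u using Finsupp.induction_linear with
    | zero => simp [AddMonoidAlgebra.one_def]
    | add f g hf hg =>
      rw [Finsupp.prod_add_index' (by simp) (by intros; rw [pow_add]), hf, hg, map_add,
        AddMonoidAlgebra.single_mul_single, one_mul]
    | single i k => rw [Finsupp.prod_single_index (by simp), h, Finsupp.linearCombination_single]
  rw [weightHom, aeval_monomial, h', ← Algebra.smul_def, AddMonoidAlgebra.smul_single, smul_eq_mul,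
    mul_one]

theorem weightHom_monoDiff_eq_zero_iff (w : σ → A) (u v : σ →₀ ℕ) :
    weightHom K w (monoDiff K u v) = 0 ↔
      Finsupp.linearCombination ℕ w u = Finsupp.linearCombination ℕ w v := by
  rw [monoDiff, map_sub, weightHom_monomial, weightHom_monomial, sub_eq_zero]
  exact AddMonoidAlgebra.single_left_inj one_ne_zero

theorem coeff_weightHom [DecidableEq A] (w : σ → A) (f : MvPolynomial σ K) (a : A) :
    (weightHom K w f).coeff a =
      ∑ e ∈ f.support, if Finsupp.linearCombination ℕ w e = a then f.coeff e else 0 := by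
  conv_lhs => rw [f.as_sum]
  rw [map_sum, AddMonoidAlgebra.coeff_sum, Finsupp.finsetSum_apply]
  refine Finset.sum_congr rfl fun e _ => ?_
  rw [weightHom_monomial, AddMonoidAlgebra.coeff_single, Finsupp.single_apply]

/-- The coefficients over each weight sum to zero in a polynomial killed by `weightHom`, so no
exponent of it is alone in its weight. -/
theorem exists_ne_of_weightHom_eq_zero {w : σ → A} {f : MvPolynomial σ K}
    (hf : weightHom K w f = 0) {d : σ →₀ ℕ} (hd : d ∈ f.support) :
    ∃ e ∈ f.support, e ≠ d ∧
      Finsupp.linearCombination ℕ w e = Finsupp.linearCombination ℕ w d := by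
  classical
  by_contra! hcon
  have h := coeff_weightHom w f (Finsupp.linearCombination ℕ w d)
  rw [hf, Finset.sum_eq_single_of_mem d hd fun e he hne => if_neg (hcon e he hne), if_pos rfl] at h
  exact mem_support_iff.mp hd h.symm

/-- `I` is the ideal of all polynomials whose coefficients sum to zero over each weight. It is
encoded by the two properties in use: `I` lies in the kernel of `weightHom`, and it contains every
difference of monomials of equal weight. -/
structure IsWeightIdeal (w : σ → A) (I : Ideal (MvPolynomial σ K)) : Prop where
  weightHom_eq_zero : ∀ f ∈ I, weightHom K w f = 0
  monoDiff_mem : ∀ u v : σ →₀ ℕ,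
    Finsupp.linearCombination ℕ w u = Finsupp.linearCombination ℕ w v → monoDiff K u v ∈ I

theorem IsWeightIdeal.monoDiff_mem_iff {w : σ → A} {I : Ideal (MvPolynomial σ K)}
    (hI : IsWeightIdeal w I) (u v : σ →₀ ℕ) :
    monoDiff K u v ∈ I ↔
      Finsupp.linearCombination ℕ w u = Finsupp.linearCombination ℕ w v :=
  ⟨fun h => (weightHom_monoDiff_eq_zero_iff w u v).mp (hI.weightHom_eq_zero _ h),
    hI.monoDiff_mem u v⟩

end Weights

/-! ### Differences of monomials -/

section MonoDiff

variable {K : Type*} [Field K] {σ : Type*}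

theorem neg_monoDiff (u v : σ →₀ ℕ) : -monoDiff K u v = monoDiff K v u := by
  rw [monoDiff, monoDiff, neg_sub]

theorem coeff_monoDiff_left {u v : σ →₀ ℕ} (h : u ≠ v) : (monoDiff K u v).coeff u = 1 := by
  classical
  simp [monoDiff, coeff_monomial, h.symm]

theorem coeff_monoDiff_right {u v : σ →₀ ℕ} (h : u ≠ v) : (monoDiff K u v).coeff v = -1 := by
  rw [← neg_neg (monoDiff K u v), neg_monoDiff, coeff_neg, coeff_monoDiff_left h.symm]

theorem mem_support_monoDiff {u v : σ →₀ ℕ} (h : u ≠ v) {d : σ →₀ ℕ} :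
    d ∈ (monoDiff K u v).support ↔ d = u ∨ d = v := by
  classical
  refine ⟨fun hd => ?_, ?_⟩
  · by_contra! hne
    refine mem_support_iff.mp hd ?_
    simp [monoDiff, coeff_monomial, hne.1.symm, hne.2.symm]
  · rintro (rfl | rfl)
    · simp [mem_support_iff, coeff_monoDiff_left h]
    · simp [mem_support_iff, coeff_monoDiff_right h]

theorem monoDiff_ne_zero_iff {u v : σ →₀ ℕ} : monoDiff K u v ≠ 0 ↔ u ≠ v := by
  refine ⟨fun h huv => h (by rw [huv, monoDiff, sub_self]), fun h h0 => ?_⟩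
  simpa [h0] using coeff_monoDiff_left (K := K) h

theorem IsPrimitiveBinomial.symm {I : Ideal (MvPolynomial σ K)} {u v : σ →₀ ℕ}
    (h : IsPrimitiveBinomial I u v) : IsPrimitiveBinomial I v u := by
  refine ⟨⟨h.1.1.symm, h.1.2.symm⟩, neg_monoDiff (K := K) u v ▸ I.neg_mem h.2.1,
    fun u' v' hp hm hu hv => ?_⟩
  exact (h.2.2 v' u' ⟨hp.1.symm, hp.2.symm⟩ (neg_monoDiff (K := K) u' v' ▸ I.neg_mem hm) hv hu).symm

end MonoDiff

/-! ### Reduced Gröbner bases -/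

namespace IsReducedGroebnerBasis

variable {K : Type*} [Field K] {σ : Type*} {ord : MonomialOrder σ}
  {I : Ideal (MvPolynomial σ K)} {G : Set (MvPolynomial σ K)}

theorem exists_degree_le (hG : IsReducedGroebnerBasis ord I G) {h : MvPolynomial σ K} (hI : h ∈ I)
    (h0 : h ≠ 0) : ∃ g ∈ G, ord.degree g ≤ ord.degree h := by
  classical
  have hlt : ord.leadingTerm '' G = (fun s => monomial s (1 : K)) '' (ord.degree '' G) := by
    rw [Set.image_image]
    exact Set.image_congr fun g hg => by
      rw [MonomialOrder.leadingTerm, (hG.monic g hg).leadingCoeff_eq_one]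
  have hmem : ord.leadingTerm h ∈ Ideal.span (ord.leadingTerm '' G) := by
    rw [hG.span_leadingTerm]
    exact Ideal.subset_span ⟨h, hI, rfl⟩
  rw [hlt, mem_ideal_span_monomial_image] at hmem
  obtain ⟨_, ⟨g, hg, rfl⟩, hle⟩ := hmem (ord.degree h) <| by
    rw [MonomialOrder.leadingTerm, mem_support_iff, coeff_monomial, if_pos rfl]
    exact ord.leadingCoeff_ne_zero_iff.mpr h0
  exact ⟨g, hg, hle⟩

/-- If the leading exponent of a nonzero `h ∈ I` divides any exponent of `g ∈ G`, then it is
divisible by the leading exponent of `g`: reducedness leaves `g` as the only basis element whose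
leading exponent may divide the one of `h`. -/
theorem degree_le_degree (hG : IsReducedGroebnerBasis ord I G) {g h : MvPolynomial σ K} (hg : g ∈ G)
    (hI : h ∈ I) (h0 : h ≠ 0) {d : σ →₀ ℕ} (hd : d ∈ g.support) (hle : ord.degree h ≤ d) :
    ord.degree g ≤ ord.degree h := by
  obtain ⟨g', hg', hle'⟩ := hG.exists_degree_le hI h0
  have : g' = g := by
    by_contra hne
    exact hG.reduced g hg g' hg' hne d hd (hle'.trans hle)
  exact this ▸ hle'

/-- An element `f` of the ideal with leading coefficient `1` belongs to the reduced Gröbner basis as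
soon as some basis element has the same leading exponent and contains all exponents of `f`. -/
theorem mem_of_support_subset (hG : IsReducedGroebnerBasis ord I G) {f g : MvPolynomial σ K}
    (hf : f ∈ I) (hg : g ∈ G) (hcoeff : f.coeff (ord.degree g) = 1)
    (hsupp : f.support ⊆ g.support) :
    f ∈ G := by
  classical
  suffices g - f = 0 by rwa [← sub_eq_zero.mp this]
  by_contra h0
  have hd := ord.degree_mem_support h0
  have hdg : ord.degree (g - f) ∈ g.support := by
    rcases Finset.mem_union.mp (support_sub σ g f hd) with h | h
    exacts [h, hsupp h]
  have h1 : ord.degree g ≤ ord.degree (g - f) :=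
    hG.degree_le_degree hg (I.sub_mem (hG.subset g hg) hf) h0 hdg le_rfl
  have h2 : ord.degree g = ord.degree (g - f) :=
    ord.toSyn.injective (le_antisymm (ord.toSyn_monotone h1) (ord.le_degree hdg))
  rw [← h2, mem_support_iff, coeff_sub, hcoeff, (hG.monic g hg).coeff_degree, sub_self] at hd
  exact hd rfl

end IsReducedGroebnerBasis

/-! ### The Lawrence lifting of a weight -/

section Lawrence

variable {ι A : Type*}

theorem exists_eq_sumElim {κ : Type*} (e : ι ⊕ κ →₀ ℕ) :
    ∃ (c : ι →₀ ℕ) (d : κ →₀ ℕ), e = Finsupp.sumElim c d :=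
  ⟨_, _, (Finsupp.comapDomain_sumElim_comapDomain e).symm⟩

theorem sumElim_le_sumElim_iff {a b c d : ι →₀ ℕ} :
    Finsupp.sumElim a b ≤ Finsupp.sumElim c d ↔ a ≤ c ∧ b ≤ d :=
  ⟨fun h => ⟨fun i => h (Sum.inl i), fun i => h (Sum.inr i)⟩,
    fun h i => i.rec (fun i => h.1 i) (fun i => h.2 i)⟩

theorem sumElim_inj {a b c d : ι →₀ ℕ} :
    Finsupp.sumElim a b = Finsupp.sumElim c d ↔ a = c ∧ b = d := by
  simp only [le_antisymm_iff, sumElim_le_sumElim_iff]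
  tauto

theorem sumElim_ne_sumElim_swap_iff {u v : ι →₀ ℕ} :
    Finsupp.sumElim u v ≠ Finsupp.sumElim v u ↔ u ≠ v := by
  rw [Ne, sumElim_inj]
  exact ⟨fun h e => h ⟨e, e.symm⟩, fun h e => h e.1⟩

/-- The weight on two copies of the variables under which `x^a y^b` and `x^c y^d` agree exactly if
`x^a` and `x^c` have equal weight and `a + b = c + d`. -/
def lawrenceWeight [AddCommMonoid A] (w : ι → A) : ι ⊕ ι → A × (ι →₀ ℕ) :=
  Sum.elim (fun i => (w i, Finsupp.single i 1)) fun i => (0, Finsupp.single i 1)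

theorem linearCombination_lawrenceWeight [AddCommMonoid A] (w : ι → A) (a b : ι →₀ ℕ) :
    Finsupp.linearCombination ℕ (lawrenceWeight w) (Finsupp.sumElim a b) =
      (Finsupp.linearCombination ℕ w a, a + b) := by
  have h1 : ∀ a : ι →₀ ℕ,
      Finsupp.linearCombination ℕ (fun i => (w i, (Finsupp.single i 1 : ι →₀ ℕ))) a =
        (Finsupp.linearCombination ℕ w a, a) := fun a => by
    induction a using Finsupp.induction_linear with
    | zero => rw [map_zero, map_zero]; rfl
    | add f g hf hg => rw [map_add, hf, hg, map_add, Prod.mk_add_mk]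
    | single i k => simp [Finsupp.linearCombination_single]
  have h2 : ∀ b : ι →₀ ℕ,
      Finsupp.linearCombination ℕ (fun i => ((0 : A), (Finsupp.single i 1 : ι →₀ ℕ))) b =
        (0, b) := fun b => by
    induction b using Finsupp.induction_linear with
    | zero => rw [map_zero]; rfl
    | add f g hf hg => rw [map_add, hf, hg, Prod.mk_add_mk, add_zero]
    | single i k => simp [Finsupp.linearCombination_single]
  rw [Finsupp.sumElim_eq_add, map_add, Finsupp.linearCombination_mapDomain,
    Finsupp.linearCombination_mapDomain]
  change Finsupp.linearCombination ℕ (fun i => (w i, (Finsupp.single i 1 : ι →₀ ℕ))) a +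
    Finsupp.linearCombination ℕ (fun i => ((0 : A), (Finsupp.single i 1 : ι →₀ ℕ))) b = _
  rw [h1, h2, Prod.mk_add_mk, add_zero]

end Lawrence

section Graver

variable {K : Type*} [Field K] {ι A : Type*} [AddCancelCommMonoid A] {w : ι → A}
  {I : Ideal (MvPolynomial ι K)} {J : Ideal (MvPolynomial (ι ⊕ ι) K)}
  {ord : MonomialOrder (ι ⊕ ι)} {G : Set (MvPolynomial (ι ⊕ ι) K)}

theorem linearCombination_tsub_eq {a c : ι →₀ ℕ}
    (h : Finsupp.linearCombination ℕ w a = Finsupp.linearCombination ℕ w c) :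
    Finsupp.linearCombination ℕ w (a - c) = Finsupp.linearCombination ℕ w (c - a) := by
  have hac : c + (a - c) = a + (c - a) := by
    ext i
    simp only [Finsupp.add_apply, Finsupp.tsub_apply]
    omega
  have := congrArg (Finsupp.linearCombination ℕ w) hac
  rw [map_add, map_add, h] at this
  exact add_left_cancel this

/-- For a primitive `x^u - x^v`, a divisor of `x^u y^v` shares its Lawrence weight with another
monomial only if it is `x^u y^v` itself, and that monomial is then `x^v y^u`. -/
theorem IsPrimitiveBinomial.eq_of_lawrenceWeight_eq {u v a b c d : ι →₀ ℕ}
    (h : IsPrimitiveBinomial I u v)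
    (hI : ∀ u v : ι →₀ ℕ, monoDiff K u v ∈ I ↔
      Finsupp.linearCombination ℕ w u = Finsupp.linearCombination ℕ w v)
    (hau : a ≤ u) (hbv : b ≤ v) (hne : Finsupp.sumElim c d ≠ Finsupp.sumElim a b)
    (hw : Finsupp.linearCombination ℕ (lawrenceWeight w) (Finsupp.sumElim c d) =
      Finsupp.linearCombination ℕ (lawrenceWeight w) (Finsupp.sumElim a b)) :
    (a = u ∧ b = v) ∧ c = v ∧ d = u := by
  simp only [linearCombination_lawrenceWeight, Prod.mk.injEq] at hw
  obtain ⟨hw, hsum⟩ := hw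
  have hs : ∀ i, c i + d i = a i + b i := fun i => DFunLike.congr_fun hsum i
  have hau' : ∀ i, a i ≤ u i := hau
  have hbv' : ∀ i, b i ≤ v i := hbv
  have hu : a - c ≤ u := tsub_le_self.trans hau
  have hv : c - a ≤ v := fun i => by
    have := hs i
    have := hbv' i
    simp only [Finsupp.tsub_apply]
    omega
  have hpure : IsPurePair (a - c) (c - a) := by
    refine ⟨fun he => hne ?_, h.1.2.mono (Finsupp.support_mono hu) (Finsupp.support_mono hv)⟩
    have he' : ∀ i, a i - c i = c i - a i := fun i => DFunLike.congr_fun he i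
    refine sumElim_inj.mpr ⟨?_, ?_⟩ <;> ext i <;> have := he' i <;> have := hs i <;> omega
  obtain ⟨h1, h2⟩ := h.2.2 _ _ hpure ((hI _ _).mpr (linearCombination_tsub_eq hw.symm)) hu hv
  have h1' : ∀ i, a i - c i = u i := fun i => DFunLike.congr_fun h1 i
  have h2' : ∀ i, c i - a i = v i := fun i => DFunLike.congr_fun h2 i
  refine ⟨⟨?_, ?_⟩, ?_, ?_⟩ <;> ext i <;> have := h1' i <;> have := h2' i <;> have := hs i <;>
    have := hau' i <;> have := hbv' i <;> omega

theorem crossBinomial_mem_iff (hJ : IsWeightIdeal (lawrenceWeight w) J) (u v : ι →₀ ℕ) :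
    crossBinomial K u v ∈ J ↔
      Finsupp.linearCombination ℕ w u = Finsupp.linearCombination ℕ w v := by
  rw [crossBinomial, hJ.monoDiff_mem_iff, linearCombination_lawrenceWeight,
    linearCombination_lawrenceWeight, Prod.mk.injEq, add_comm u v, and_iff_left rfl]

/-- A basis element `g` whose leading monomial divides `x^u y^v` has a second monomial of the same
Lawrence weight as the leading one; so it contains `x^u y^v` and `x^v y^u`, and equals the binomial
by reducedness. -/
theorem IsPrimitiveBinomial.crossBinomial_mem_of_degree_le {u v : ι →₀ ℕ}
    (h : IsPrimitiveBinomial I u v)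
    (hI : ∀ u v : ι →₀ ℕ, monoDiff K u v ∈ I ↔
      Finsupp.linearCombination ℕ w u = Finsupp.linearCombination ℕ w v)
    (hJ : IsWeightIdeal (lawrenceWeight w) J) (hG : IsReducedGroebnerBasis ord J G)
    {g : MvPolynomial (ι ⊕ ι) K} (hg : g ∈ G) (hle : ord.degree g ≤ Finsupp.sumElim u v) :
    crossBinomial K u v ∈ G := by
  obtain ⟨a, b, hab⟩ := exists_eq_sumElim (ord.degree g)
  have hsupp := ord.degree_mem_support (hG.monic g hg).ne_zero
  obtain ⟨e, he, hne, hw⟩ :=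
    exists_ne_of_weightHom_eq_zero (hJ.weightHom_eq_zero g (hG.subset g hg)) hsupp
  obtain ⟨c, d, rfl⟩ := exists_eq_sumElim e
  rw [hab] at hne hw hle hsupp
  rw [sumElim_le_sumElim_iff] at hle
  obtain ⟨⟨rfl, rfl⟩, rfl, rfl⟩ := h.eq_of_lawrenceWeight_eq hI hle.1 hle.2 hne hw
  refine hG.mem_of_support_subset
    ((crossBinomial_mem_iff hJ _ _).mpr ((hI _ _).mp h.2.1)) hg ?_ fun x hx => ?_
  · rw [hab]
    exact coeff_monoDiff_left hne.symm
  · rcases (mem_support_monoDiff hne.symm).mp hx with rfl | rfl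
    exacts [hsupp, he]

theorem IsPrimitiveBinomial.crossBinomial_mem_or {u v : ι →₀ ℕ}
    (h : IsPrimitiveBinomial I u v)
    (hI : ∀ u v : ι →₀ ℕ, monoDiff K u v ∈ I ↔
      Finsupp.linearCombination ℕ w u = Finsupp.linearCombination ℕ w v)
    (hJ : IsWeightIdeal (lawrenceWeight w) J) (hG : IsReducedGroebnerBasis ord J G) :
    crossBinomial K u v ∈ G ∨ crossBinomial K v u ∈ G := by
  have hne : Finsupp.sumElim u v ≠ Finsupp.sumElim v u := sumElim_ne_sumElim_swap_iff.mpr h.1.1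
  have h0 : crossBinomial K u v ≠ 0 := monoDiff_ne_zero_iff.mpr hne
  obtain ⟨g, hg, hle⟩ :=
    hG.exists_degree_le ((crossBinomial_mem_iff hJ u v).mpr ((hI u v).mp h.2.1)) h0
  rcases (mem_support_monoDiff hne).mp (ord.degree_mem_support h0) with hd | hd
  · exact Or.inl (h.crossBinomial_mem_of_degree_le hI hJ hG hg (hle.trans_eq hd))
  · exact Or.inr (h.symm.crossBinomial_mem_of_degree_le hI hJ hG hg (hle.trans_eq hd))

/-- If `x^u y^v - x^v y^u` is in the reduced Gröbner basis, no `x^u' - x^v'` with distinct monomials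
of equal weight lies properly below `x^u - x^v`; the monomials of the smaller binomial need not be
relatively prime. -/
theorem eq_of_crossBinomial_mem (hJ : IsWeightIdeal (lawrenceWeight w) J)
    (hG : IsReducedGroebnerBasis ord J G) {u v u' v' : ι →₀ ℕ} (h : crossBinomial K u v ∈ G)
    (hne' : u' ≠ v')
    (hw : Finsupp.linearCombination ℕ w u' = Finsupp.linearCombination ℕ w v')
    (hu : u' ≤ u) (hv : v' ≤ v) : u' = u ∧ v' = v := by
  have h0 : crossBinomial K u v ≠ 0 := (hG.monic _ h).ne_zero
  have hne := monoDiff_ne_zero_iff.mp h0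
  have hs' := sumElim_ne_sumElim_swap_iff.mpr hne'
  have h0' : crossBinomial K u' v' ≠ 0 := monoDiff_ne_zero_iff.mpr hs'
  have hmem := (crossBinomial_mem_iff hJ u' v').mpr hw
  -- The leading monomial of the smaller binomial divides the corresponding term of the larger one,
  -- hence is divisible by the leading monomial of the larger one.
  have key : ∀ {a b a' b' : ι →₀ ℕ}, ord.degree (crossBinomial K u' v') = Finsupp.sumElim a' b' →
      Finsupp.sumElim a b ∈ (crossBinomial K u v).support → a' ≤ a → b' ≤ b →
      Finsupp.sumElim u v ≤ Finsupp.sumElim a' b' ∨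
        Finsupp.sumElim v u ≤ Finsupp.sumElim a' b' := by
    intro a b a' b' hd hs ha hb
    have hle := hG.degree_le_degree h hmem h0' hs (hd ▸ sumElim_le_sumElim_iff.mpr ⟨ha, hb⟩)
    rw [hd] at hle
    rcases (mem_support_monoDiff hne).mp (ord.degree_mem_support h0) with he | he
    · exact Or.inl (he ▸ hle)
    · exact Or.inr (he ▸ hle)
  rcases (mem_support_monoDiff hs').mp (ord.degree_mem_support h0') with hd | hd
  · rcases key hd ((mem_support_monoDiff hne).mpr (Or.inl rfl)) hu hv with h | h <;>
      obtain ⟨h1, h2⟩ := sumElim_le_sumElim_iff.mp h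
    · exact ⟨hu.antisymm h1, hv.antisymm h2⟩
    · exact ⟨hu.antisymm (h2.trans (hv.trans h1)), hv.antisymm (h1.trans (hu.trans h2))⟩
  · rcases key hd ((mem_support_monoDiff hne).mpr (Or.inr rfl)) hv hu with h | h <;>
      obtain ⟨h1, h2⟩ := sumElim_le_sumElim_iff.mp h
    · exact ⟨hu.antisymm (h1.trans (hv.trans h2)), hv.antisymm (h2.trans (hu.trans h1))⟩
    · exact ⟨hu.antisymm h2, hv.antisymm h1⟩

theorem isPrimitiveBinomial_of_crossBinomial_mem
    (hI : ∀ u v : ι →₀ ℕ, monoDiff K u v ∈ I ↔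
      Finsupp.linearCombination ℕ w u = Finsupp.linearCombination ℕ w v)
    (hJ : IsWeightIdeal (lawrenceWeight w) J) (hG : IsReducedGroebnerBasis ord J G)
    {u v : ι →₀ ℕ} (h : crossBinomial K u v ∈ G) : IsPrimitiveBinomial I u v := by
  have hne : u ≠ v :=
    sumElim_ne_sumElim_swap_iff.mp (monoDiff_ne_zero_iff.mp (hG.monic _ h).ne_zero)
  have hw := (crossBinomial_mem_iff hJ u v).mp (hG.subset _ h)
  refine ⟨⟨hne, ?_⟩, (hI u v).mpr hw, fun u' v' hp hm hu hv =>
    eq_of_crossBinomial_mem hJ hG h hp.1 ((hI _ _).mp hm) hu hv⟩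
  -- Cancelling the common factor of the two monomials leaves a binomial below `x^u - x^v`.
  have hne' : u - v ≠ v - u := fun he => hne <| by
    ext i
    have : u i - v i = v i - u i := DFunLike.congr_fun he i
    omega
  obtain ⟨h1, h2⟩ := eq_of_crossBinomial_mem hJ hG h hne' (linearCombination_tsub_eq hw)
    tsub_le_self tsub_le_self
  refine Finset.disjoint_left.mpr fun i hiu hiv => ?_
  have h1' : u i - v i = u i := DFunLike.congr_fun h1 i
  rw [Finsupp.mem_support_iff] at hiu hiv
  omega

theorem graverBasis_eq (hI : ∀ u v : ι →₀ ℕ, monoDiff K u v ∈ I ↔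
      Finsupp.linearCombination ℕ w u = Finsupp.linearCombination ℕ w v)
    (hJ : IsWeightIdeal (lawrenceWeight w) J) (hG : IsReducedGroebnerBasis ord J G) :
    graverBasis I = {f | f ∈ uncross G ∨ -f ∈ uncross G} := by
  ext f
  constructor
  · rintro ⟨u, v, h, rfl⟩
    rcases h.crossBinomial_mem_or hI hJ hG with hm | hm
    · exact Or.inl ⟨u, v, hm, rfl⟩
    · exact Or.inr ⟨v, u, hm, neg_monoDiff u v⟩
  · rintro (⟨u, v, hm, rfl⟩ | ⟨u, v, hm, hf⟩)
    · exact ⟨u, v, isPrimitiveBinomial_of_crossBinomial_mem hI hJ hG hm, rfl⟩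
    · refine ⟨v, u, (isPrimitiveBinomial_of_crossBinomial_mem hI hJ hG hm).symm, ?_⟩
      rw [← neg_monoDiff, ← hf, neg_neg]

/-- Only one of a binomial and its negative is monic, unless `1 = -1` in `K`. -/
theorem neg_eq_self_of_mem_uncross (hG : IsReducedGroebnerBasis ord J G) {f : MvPolynomial ι K}
    (hf : f ∈ uncross G) (hf' : -f ∈ uncross G) : -f = f := by
  obtain ⟨u, v, hm, rfl⟩ := hf
  obtain ⟨u', v', hm', he⟩ := hf'
  have hne : u ≠ v :=
    sumElim_ne_sumElim_swap_iff.mp (monoDiff_ne_zero_iff.mp (hG.monic _ hm).ne_zero)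
  have hne' : u' ≠ v' :=
    sumElim_ne_sumElim_swap_iff.mp (monoDiff_ne_zero_iff.mp (hG.monic _ hm').ne_zero)
  suffices h : (-1 : K) = 1 by
    have h' : (-1 : MvPolynomial ι K) = 1 := by rw [← C_1, ← C_neg, h]
    rw [← neg_one_mul, h', one_mul]
  by_contra h1
  rw [neg_monoDiff] at he
  have hv : v = u' := by
    by_contra hvu
    have hv : v ∈ (monoDiff K u' v').support :=
      he ▸ (mem_support_monoDiff hne.symm).mpr (Or.inl rfl)
    rcases (mem_support_monoDiff hne').mp hv with h | h
    · exact hvu h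
    · have := coeff_monoDiff_left (K := K) hne.symm
      rw [he, h, coeff_monoDiff_right hne'] at this
      exact h1 this
  have hu : u = v' := by
    have hu : u ∈ (monoDiff K u' v').support :=
      he ▸ (mem_support_monoDiff hne.symm).mpr (Or.inr rfl)
    rcases (mem_support_monoDiff hne').mp hu with h | h
    · exact absurd (h.trans hv.symm) hne
    · exact h
  subst hv hu
  have h2 : crossBinomial K v u = -crossBinomial K u v := (neg_monoDiff _ _).symm
  have h3 := (hG.monic _ hm').coeff_degree
  rw [h2, coeff_neg, ord.degree_neg, (hG.monic _ hm).coeff_degree] at h3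
  exact h1 h3

end Graver

/-! ### The ideal of the `p`-Lawrence lifting -/

section LawrenceIdeal

variable {K : Type*} [Field K] {ρ ι : Type*}

/-- The columns of an integer matrix, reduced modulo `p`. -/
def columnWeight (p : ℕ) (D : Matrix ρ ι ℤ) (i : ι) : ρ → ZMod p := fun r => (D r i : ZMod p)

theorem substOne_monoDiff {τ : Type*} (a b : τ →₀ ℕ) (s t : ρ →₀ ℕ) :
    substOne K τ ρ (monoDiff K (Finsupp.sumElim a s) (Finsupp.sumElim b t)) = monoDiff K a b := by
  have h : ∀ (a : τ →₀ ℕ) (s : ρ →₀ ℕ),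
      substOne K τ ρ (monomial (Finsupp.sumElim a s) 1) = monomial a 1 := fun a s => by
    rw [substOne, aeval_monomial, map_one, one_mul, Finsupp.prod_sumElim, monomial_eq, C_1, one_mul]
    simp [Function.comp_def]
  rw [monoDiff, map_sub, h, h, monoDiff]

theorem linearCombination_columnWeight [Fintype ι] (p : ℕ) (D : Matrix ρ ι ℤ) (u : ι →₀ ℕ) (r : ρ) :
    Finsupp.linearCombination ℕ (columnWeight p D) u r =
      ((D.mulVec (fun i => (u i : ℤ)) r : ℤ) : ZMod p) := by
  rw [Finsupp.linearCombination_apply, Finsupp.sum_fintype _ _ (by simp)]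
  simp [Matrix.mulVec, dotProduct, columnWeight, mul_comm]

variable [Fintype ρ] [Fintype ι] [DecidableEq ρ] [DecidableEq ι]

theorem pLawrence_mulVec_eq_iff (p : ℕ) (D : Matrix ρ ι ℤ) (a b c d : ι →₀ ℕ) (s t : ρ →₀ ℕ) :
    (pLawrence p D).mulVec
        (fun i => (Finsupp.sumElim (Finsupp.sumElim a b) s i : ℤ)) =
      (pLawrence p D).mulVec
        (fun i => (Finsupp.sumElim (Finsupp.sumElim c d) t i : ℤ)) ↔
    (∀ r, D.mulVec (fun i => (a i : ℤ)) r + p * s r = D.mulVec (fun i => (c i : ℤ)) r + p * t r) ∧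
      a + b = c + d := by
  have h : ∀ (a b : ι →₀ ℕ) (s : ρ →₀ ℕ), (pLawrence p D).mulVec
      (fun i => (Finsupp.sumElim (Finsupp.sumElim a b) s i : ℤ)) =
      Sum.elim (fun r => D.mulVec (fun i => (a i : ℤ)) r + p * s r)
        (fun i => ((a i + b i : ℕ) : ℤ)) := fun a b s => by
    have e : (fun i => (Finsupp.sumElim (Finsupp.sumElim a b) s i : ℤ)) =
        Sum.elim (Sum.elim (fun i => (a i : ℤ)) (fun i => (b i : ℤ))) (fun r => (s r : ℤ)) := by
      ext ((i | i) | i) <;> rfl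
    rw [e, pLawrence, Matrix.fromBlocks_mulVec, Sum.elim_comp_inl, Sum.elim_comp_inr]
    ext (r | i) <;> simp [Matrix.fromCols_mulVec]
  rw [h, h, Sum.elim_eq_iff]
  simp only [_root_.funext_iff, Nat.cast_inj, Finsupp.ext_iff, Finsupp.add_apply]

theorem isWeightIdeal_lawrenceIdeal (p : ℕ) (D : Matrix ρ ι ℤ) :
    IsWeightIdeal (lawrenceWeight (columnWeight p D)) (lawrenceIdeal K p D) := by
  constructor
  · suffices h : lawrenceIdeal K p D ≤
        RingHom.ker (weightHom K (lawrenceWeight (columnWeight p D))) from h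
    rw [lawrenceIdeal, Ideal.map_le_iff_le_comap, toricIdeal, Ideal.span_le]
    rintro _ ⟨u, v, huv, rfl⟩
    obtain ⟨x, s, rfl⟩ := exists_eq_sumElim u
    obtain ⟨a, b, rfl⟩ := exists_eq_sumElim x
    obtain ⟨y, t, rfl⟩ := exists_eq_sumElim v
    obtain ⟨c, d, rfl⟩ := exists_eq_sumElim y
    obtain ⟨h1, h2⟩ := (pLawrence_mulVec_eq_iff p D a b c d s t).mp huv
    change weightHom K _ (substOne K _ _ _) = 0
    rw [substOne_monoDiff, weightHom_monoDiff_eq_zero_iff, linearCombination_lawrenceWeight,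
      linearCombination_lawrenceWeight, h2]
    refine congrArg (·, c + d) (_root_.funext fun r => ?_)
    have := congrArg (Int.cast : ℤ → ZMod p) (h1 r)
    rw [linearCombination_columnWeight, linearCombination_columnWeight]
    simpa using this
  · intro u v huv
    obtain ⟨a, b, rfl⟩ := exists_eq_sumElim u
    obtain ⟨c, d, rfl⟩ := exists_eq_sumElim v
    rw [linearCombination_lawrenceWeight, linearCombination_lawrenceWeight, Prod.mk.injEq] at huv
    have hdvd : ∀ r, ∃ k : ℤ, D.mulVec (fun i => (c i : ℤ)) r - D.mulVec (fun i => (a i : ℤ)) r =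
        p * k := fun r => by
      have := congrFun huv.1 r
      rw [linearCombination_columnWeight, linearCombination_columnWeight] at this
      exact (ZMod.intCast_eq_intCast_iff_dvd_sub _ _ p).mp this
    choose k hk using hdvd
    -- The exponents of `z` absorb the multiples of `p`: the positive parts of `k` and of `-k`.
    let s : ρ →₀ ℕ := Finsupp.equivFunOnFinite.symm fun r => (k r).toNat
    let t : ρ →₀ ℕ := Finsupp.equivFunOnFinite.symm fun r => (-k r).toNat
    rw [← substOne_monoDiff (K := K) (Finsupp.sumElim a b) (Finsupp.sumElim c d) s t]
    refine Ideal.mem_map_of_mem _ (Ideal.subset_span ⟨_, _, ?_, rfl⟩)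
    refine (pLawrence_mulVec_eq_iff p D a b c d s t).mpr ⟨fun r => ?_, huv.2⟩
    have hst : (s r : ℤ) - t r = k r := Int.toNat_sub_toNat_neg (k r)
    linear_combination (p : ℤ) * hst - hk r

end LawrenceIdeal

/-! ### Congruence of monomials modulo the code -/

section MonoDiffMem

variable {K : Type*} [Field K] {σ : Type*} {I : Ideal (MvPolynomial σ K)}

theorem monoDiff_self_mem (u : σ →₀ ℕ) : monoDiff K u u ∈ I := by
  rw [monoDiff, sub_self]
  exact I.zero_mem

theorem monoDiff_mem_symm {u v : σ →₀ ℕ} (h : monoDiff K u v ∈ I) : monoDiff K v u ∈ I :=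
  neg_monoDiff (K := K) u v ▸ I.neg_mem h

theorem monoDiff_mem_trans {u v w : σ →₀ ℕ} (h : monoDiff K u v ∈ I) (h' : monoDiff K v w ∈ I) :
    monoDiff K u w ∈ I := by
  have := I.add_mem h h'
  rwa [monoDiff, monoDiff, sub_add_sub_cancel] at this

theorem monoDiff_add_left_mem {u v : σ →₀ ℕ} (t : σ →₀ ℕ) (h : monoDiff K u v ∈ I) :
    monoDiff K (t + u) (t + v) ∈ I := by
  have := I.mul_mem_left (monomial t 1) h
  rwa [monoDiff, mul_sub, monomial_mul, monomial_mul, one_mul] at this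

end MonoDiffMem

section Crossing

variable {F : Type*} [Field F] {n q : ℕ} {α : F}

/-- The word with entry `α ^ s` at position `j` and zeros elsewhere, for the variable `(j, s)`; as
in `crossing`, the index `s : Fin (q - 1)` stands for the exponent `s + 1`. -/
def symbolWeight (n q : ℕ) (α : F) (i : Fin n × Fin (q - 1)) : Fin n → F :=
  Pi.single i.1 (α ^ (i.2.val + 1))

theorem IsPrimitiveRoot.exists_eq_pow_succ [Fintype F] (hα : IsPrimitiveRoot α (q - 1))
    (hq : Fintype.card F = q) {x : F} (hx : x ≠ 0) : ∃ s : Fin (q - 1), x = α ^ (s.val + 1) := by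
  have hpos : 0 < q - 1 := by
    have := Fintype.one_lt_card (α := F)
    omega
  have : NeZero (q - 1) := ⟨hpos.ne'⟩
  have hα0 : α ≠ 0 := hα.ne_zero hpos.ne'
  obtain ⟨i, hi, he⟩ := hα.eq_pow_of_pow_eq_one (ξ := x * α⁻¹)
    (hq ▸ FiniteField.pow_card_sub_one_eq_one _ (mul_ne_zero hx (inv_ne_zero hα0)))
  exact ⟨⟨i, hi⟩, by rw [pow_succ, he, inv_mul_cancel_right₀ hα0]⟩

theorem IsPrimitiveRoot.pow_succ_inj (hα : IsPrimitiveRoot α (q - 1)) {s t : Fin (q - 1)} :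
    α ^ (s.val + 1) = α ^ (t.val + 1) ↔ s = t := by
  refine ⟨fun h => Fin.ext (hα.pow_inj s.2 t.2 ?_), fun h => h ▸ rfl⟩
  have hα0 : α ≠ 0 := hα.ne_zero (by have := s.2; omega)
  exact mul_right_cancel₀ hα0 (by simpa [pow_succ] using h)

theorem IsPrimitiveRoot.pow_succ_ne_zero (hα : IsPrimitiveRoot α (q - 1)) (s : Fin (q - 1)) :
    α ^ (s.val + 1) ≠ 0 :=
  pow_ne_zero _ (hα.ne_zero (by have := s.2; omega))

theorem crossing_update_pow (hα : IsPrimitiveRoot α (q - 1)) (a : Fin n → F) (j : Fin n)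
    (s : Fin (q - 1)) :
    crossing (q := q) α (Function.update a j (α ^ (s.val + 1))) =
      crossing α (Function.update a j 0) + Finsupp.single (j, s) 1 := by
  classical
  ext ⟨j', s'⟩
  rcases eq_or_ne j' j with rfl | hj
  · simp [crossing, hα.pow_succ_inj, (hα.pow_succ_ne_zero s').symm, Finsupp.single_apply]
  · simp [crossing, hj]

theorem crossing_zero (hα : IsPrimitiveRoot α (q - 1)) :
    crossing (n := n) (q := q) α 0 = 0 := by
  ext i
  simp [crossing, (hα.pow_succ_ne_zero i.2).symm]

theorem crossing_single (hα : IsPrimitiveRoot α (q - 1)) (j : Fin n) (s : Fin (q - 1)) :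
    crossing (q := q) α (Pi.single j (α ^ (s.val + 1))) = Finsupp.single (j, s) 1 := by
  rw [Pi.single, crossing_update_pow hα, Function.update_eq_self_iff.mpr (by simp),
    crossing_zero hα, zero_add]

theorem linearCombination_symbolWeight_crossing [Fintype F] (hα : IsPrimitiveRoot α (q - 1))
    (hq : Fintype.card F = q) (a : Fin n → F) :
    Finsupp.linearCombination ℕ (symbolWeight n q α) (crossing α a) = a := by
  classical
  ext j
  rw [Finsupp.linearCombination_apply, Finsupp.sum_fintype _ _ (by simp), Finset.sum_apply,
    Fintype.sum_prod_type, Finset.sum_eq_single j]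
  · simp only [crossing, symbolWeight, Finsupp.equivFunOnFinite_symm_apply_apply, Pi.smul_apply,
      Pi.single_eq_same, ite_smul, one_smul, zero_smul]
    by_cases h0 : a j = 0
    · simp [h0, (hα.pow_succ_ne_zero _).symm]
    · obtain ⟨t, ht⟩ := hα.exists_eq_pow_succ hq h0
      simp [ht, hα.pow_succ_inj]
  · intro j' _ hj
    simp [symbolWeight, hj.symm]
  · simp

end Crossing

section CodeIdeals

variable {K F : Type*} [Field K] [Field F] {n q : ℕ} {α : F}

theorem additiveIdeal_le_iff {I : Ideal (MvPolynomial (Fin n × Fin (q - 1)) K)} :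
    additiveIdeal K n q α ≤ I ↔
      (∀ (j : Fin n) (u v w : Fin (q - 1)),
        α ^ (u.val + 1) + α ^ (v.val + 1) = α ^ (w.val + 1) →
          monoDiff K (Finsupp.single (j, u) 1 + Finsupp.single (j, v) 1)
            (Finsupp.single (j, w) 1) ∈ I) ∧
      ∀ (j : Fin n) (u v : Fin (q - 1)), α ^ (u.val + 1) + α ^ (v.val + 1) = 0 →
        monoDiff K (Finsupp.single (j, u) 1 + Finsupp.single (j, v) 1) 0 ∈ I := by
  have h1 : ∀ i i' k : Fin n × Fin (q - 1), (X i * X i' - X k : MvPolynomial _ K) =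
      monoDiff K (Finsupp.single i 1 + Finsupp.single i' 1) (Finsupp.single k 1) := by
    intro i i' k
    rw [monoDiff, X, X, X, monomial_mul, one_mul]
  have h2 : ∀ i i' : Fin n × Fin (q - 1), (X i * X i' - 1 : MvPolynomial _ K) =
      monoDiff K (Finsupp.single i 1 + Finsupp.single i' 1) 0 := by
    intro i i'
    rw [monoDiff, X, X, monomial_mul, one_mul, monomial_zero', C_1]
  rw [additiveIdeal, Ideal.span_le, Set.union_subset_iff]
  refine and_congr ⟨fun h j u v w huv => ?_, ?_⟩ ⟨fun h j u v huv => ?_, ?_⟩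
  · exact h1 _ _ _ ▸ h ⟨j, u, v, w, huv, rfl⟩
  · rintro h _ ⟨j, u, v, w, huv, rfl⟩
    exact h1 _ _ _ ▸ h j u v w huv
  · exact h2 _ _ ▸ h ⟨j, u, v, huv, rfl⟩
  · rintro h _ ⟨j, u, v, huv, rfl⟩
    exact h2 _ _ ▸ h j u v huv

theorem monoDiff_single_add_crossing_mem [Fintype F] (hq : Fintype.card F = q)
    (hα : IsPrimitiveRoot α (q - 1)) {I : Ideal (MvPolynomial (Fin n × Fin (q - 1)) K)}
    (hI : additiveIdeal K n q α ≤ I) (a : Fin n → F) (j : Fin n) (s : Fin (q - 1)) :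
    monoDiff K (Finsupp.single (j, s) 1 + crossing α a)
      (crossing α (a + Pi.single j (α ^ (s.val + 1)))) ∈ I := by
  obtain ⟨hI1, hI2⟩ := additiveIdeal_le_iff.mp hI
  have hupd : a + Pi.single j (α ^ (s.val + 1)) =
      Function.update a j (α ^ (s.val + 1) + a j) := by
    ext k
    rcases eq_or_ne k j with rfl | hk
    · simp [add_comm]
    · simp [hk]
  rw [hupd]
  by_cases h0 : a j = 0
  · rw [h0, add_zero, crossing_update_pow hα, ← h0, Function.update_eq_self, add_comm]
    exact monoDiff_self_mem _
  · obtain ⟨t, ht⟩ := hα.exists_eq_pow_succ hq h0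
    have ha : crossing (q := q) α a =
        crossing α (Function.update a j 0) + Finsupp.single (j, t) 1 := by
      rw [← crossing_update_pow hα, ← ht, Function.update_eq_self]
    rw [ha, add_left_comm]
    by_cases hs : α ^ (s.val + 1) + a j = 0
    · rw [hs]
      simpa using monoDiff_add_left_mem (crossing α (Function.update a j 0)) (hI2 j s t (ht ▸ hs))
    · obtain ⟨w, hw⟩ := hα.exists_eq_pow_succ hq hs
      rw [hw, crossing_update_pow hα]
      exact monoDiff_add_left_mem _ (hI1 j s t w (ht ▸ hw))

/-- Modulo the additive relations, every monomial is congruent to the one obtained by crossing the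
word it represents. -/
theorem monoDiff_crossing_mem [Fintype F] (hq : Fintype.card F = q)
    (hα : IsPrimitiveRoot α (q - 1)) {I : Ideal (MvPolynomial (Fin n × Fin (q - 1)) K)}
    (hI : additiveIdeal K n q α ≤ I) (u : Fin n × Fin (q - 1) →₀ ℕ) :
    monoDiff K u (crossing α (Finsupp.linearCombination ℕ (symbolWeight n q α) u)) ∈ I := by
  suffices h : ∀ a : Fin n → F, monoDiff K (u + crossing α a)
      (crossing α (a + Finsupp.linearCombination ℕ (symbolWeight n q α) u)) ∈ I by
    simpa [crossing_zero hα] using h 0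
  have hadd : ∀ f g : Fin n × Fin (q - 1) →₀ ℕ,
      (∀ a : Fin n → F, monoDiff K (f + crossing α a)
        (crossing α (a + Finsupp.linearCombination ℕ (symbolWeight n q α) f)) ∈ I) →
      (∀ a : Fin n → F, monoDiff K (g + crossing α a)
        (crossing α (a + Finsupp.linearCombination ℕ (symbolWeight n q α) g)) ∈ I) →
      ∀ a : Fin n → F, monoDiff K (f + g + crossing α a)
        (crossing α (a + Finsupp.linearCombination ℕ (symbolWeight n q α) (f + g))) ∈ I := by
    intro f g hf hg a
    rw [add_assoc, map_add, add_comm (Finsupp.linearCombination ℕ _ f), ← add_assoc a]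
    exact monoDiff_mem_trans (monoDiff_add_left_mem f (hg a)) (hf _)
  induction u using Finsupp.induction_linear with
  | zero => exact fun a => by simpa using monoDiff_self_mem _
  | add f g hf hg => exact hadd f g hf hg
  | single i k =>
    induction k with
    | zero => exact fun a => by simpa using monoDiff_self_mem _
    | succ k ih =>
      rw [Finsupp.single_add]
      refine hadd _ _ ih fun a => ?_
      rw [Finsupp.linearCombination_single, one_smul]
      exact monoDiff_single_add_crossing_mem hq hα hI a i.1 i.2

/-- If no coordinate vanishes identically on the code, the additive relations already hold modulo
the generalized code ideal: a codeword `c` with `c j = α ^ v` allows replacing `X (j, v)` by a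
monomial without variables at position `j`, to which `X (j, u)` may be multiplied. -/
theorem additiveIdeal_le_genCodeIdeal (hα : IsPrimitiveRoot α (q - 1))
    {C : Submodule F (Fin n → F)} (hC : ∀ j : Fin n, ∃ c ∈ C, c j ≠ 0) :
    additiveIdeal K n q α ≤ genCodeIdeal K q α C := by
  have key : ∀ (j : Fin n) (u v : Fin (q - 1)),
      monoDiff K (Finsupp.single (j, u) 1 + Finsupp.single (j, v) 1)
        (crossing α (Pi.single j (α ^ (u.val + 1) + α ^ (v.val + 1)))) ∈ genCodeIdeal K q α C := by
    intro j u v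
    obtain ⟨c, hc, hcv⟩ : ∃ c ∈ C, c j = α ^ (v.val + 1) := by
      obtain ⟨c, hc, hcj⟩ := hC j
      exact ⟨(α ^ (v.val + 1) / c j) • c, C.smul_mem _ hc, by simp [hcj]⟩
    have h1 : monoDiff K (Finsupp.single (j, v) 1) (crossing α (Function.update (-c) j 0)) ∈
        genCodeIdeal K q α C := by
      refine Ideal.subset_span ⟨Pi.single j (α ^ (v.val + 1)), Function.update (-c) j 0, ?_,
        by rw [crossing_single hα]⟩
      convert hc using 1
      ext k
      rcases eq_or_ne k j with rfl | hk
      · simp [hcv]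
      · simp [hk]
    refine monoDiff_mem_trans (monoDiff_add_left_mem _ h1) ?_
    rw [add_comm, ← crossing_update_pow hα]
    refine Ideal.subset_span ⟨_, _, ?_, rfl⟩
    convert C.neg_mem hc using 1
    ext k
    rcases eq_or_ne k j with rfl | hk
    · simp [hcv]
    · simp [hk]
  refine additiveIdeal_le_iff.mpr ⟨fun j u v w h => ?_, fun j u v h => ?_⟩
  · simpa only [h, crossing_single hα] using key j u v
  · simpa only [h, Pi.single_zero, crossing_zero hα] using key j u v

/-- The class modulo the code of the word represented by a variable. -/
def codeWeight (q : ℕ) (α : F) (C : Submodule F (Fin n → F)) (i : Fin n × Fin (q - 1)) :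
    (Fin n → F) ⧸ C :=
  C.mkQ (symbolWeight n q α i)

theorem linearCombination_codeWeight (C : Submodule F (Fin n → F))
    (u : Fin n × Fin (q - 1) →₀ ℕ) :
    Finsupp.linearCombination ℕ (codeWeight q α C) u =
      C.mkQ (Finsupp.linearCombination ℕ (symbolWeight n q α) u) := by
  rw [Finsupp.linearCombination_apply, Finsupp.linearCombination_apply, map_finsuppSum]
  simp only [map_nsmul, codeWeight]

theorem linearCombination_codeWeight_eq_iff (C : Submodule F (Fin n → F))
    (u v : Fin n × Fin (q - 1) →₀ ℕ) :
    Finsupp.linearCombination ℕ (codeWeight q α C) u =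
      Finsupp.linearCombination ℕ (codeWeight q α C) v ↔
    Finsupp.linearCombination ℕ (symbolWeight n q α) u -
      Finsupp.linearCombination ℕ (symbolWeight n q α) v ∈ C := by
  rw [linearCombination_codeWeight, linearCombination_codeWeight]
  exact Submodule.Quotient.eq C

theorem isWeightIdeal_sup [Fintype F] (hq : Fintype.card F = q)
    (hα : IsPrimitiveRoot α (q - 1)) (C : Submodule F (Fin n → F)) :
    IsWeightIdeal (codeWeight q α C) (genCodeIdeal K q α C ⊔ additiveIdeal K n q α) := by
  constructor
  · suffices h : genCodeIdeal K q α C ⊔ additiveIdeal K n q α ≤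
        RingHom.ker (weightHom K (codeWeight q α C)) from h
    refine sup_le (Ideal.span_le.mpr ?_) (additiveIdeal_le_iff.mpr ⟨?_, ?_⟩)
    · rintro _ ⟨a, b, hab, rfl⟩
      refine (weightHom_monoDiff_eq_zero_iff _ _ _).mpr
        ((linearCombination_codeWeight_eq_iff C _ _).mpr ?_)
      rwa [linearCombination_symbolWeight_crossing hα hq,
        linearCombination_symbolWeight_crossing hα hq]
    · intro j u v w h
      refine (weightHom_monoDiff_eq_zero_iff _ _ _).mpr
        ((linearCombination_codeWeight_eq_iff C _ _).mpr ?_)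
      simp [Finsupp.linearCombination_single, symbolWeight, ← Pi.single_add, h]
    · intro j u v h
      refine (weightHom_monoDiff_eq_zero_iff _ _ _).mpr
        ((linearCombination_codeWeight_eq_iff C _ _).mpr ?_)
      simp [Finsupp.linearCombination_single, symbolWeight, ← Pi.single_add, h]
  · intro u v huv
    have h := monoDiff_crossing_mem (K := K) (n := n) hq hα
      (le_sup_right (a := genCodeIdeal K q α C))
    refine monoDiff_mem_trans (h u) (monoDiff_mem_trans ?_ (monoDiff_mem_symm (h v)))
    exact Ideal.mem_sup_left (Ideal.subset_span
      ⟨_, _, (linearCombination_codeWeight_eq_iff C u v).mp huv, rfl⟩)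

end CodeIdeals

/-! ### The extended parity-check matrix -/

section ParityCheck

variable {F : Type*} [Field F] {p r q n m : ℕ} [Algebra (ZMod p) F]

/-- The syndrome of a word, written out in coordinates over the prime field. -/
def syndromeCoords (B : Module.Basis (Fin r) (ZMod p) F) (H : Matrix (Fin m) (Fin n) F) :
    (Fin n → F) →+ (Fin m × Fin r → ZMod p) where
  toFun x i := B.repr (H.mulVec x i.1) i.2
  map_zero' := by
    ext i
    simp
  map_add' x y := by
    ext i
    simp [Matrix.mulVec_add]

theorem syndromeCoords_eq_iff (B : Module.Basis (Fin r) (ZMod p) F)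
    (H : Matrix (Fin m) (Fin n) F) (x y : Fin n → F) :
    syndromeCoords B H x = syndromeCoords B H y ↔ Matrix.vecMul (x - y) H.transpose = 0 := by
  rw [Matrix.vecMul_transpose, Matrix.mulVec_sub, sub_eq_zero]
  refine ⟨fun h => ?_, fun h => ?_⟩
  · ext i
    exact B.repr.injective (Finsupp.ext fun l => congrFun h (i, l))
  · ext i
    exact congrArg (fun z => B.repr (z i.1) i.2) h

theorem linearCombination_columnWeight_eq_syndromeCoords {α : F}
    (B : Module.Basis (Fin r) (ZMod p) F) (H : Matrix (Fin m) (Fin n) F)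
    {D : Matrix (Fin m × Fin r) (Fin n × Fin (q - 1)) ℤ}
    (hD : D.map (Int.cast : ℤ → ZMod p) = extendedMatrix q α B H)
    (u : Fin n × Fin (q - 1) →₀ ℕ) :
    Finsupp.linearCombination ℕ (columnWeight p D) u =
      syndromeCoords B H (Finsupp.linearCombination ℕ (symbolWeight n q α) u) := by
  rw [Finsupp.linearCombination_apply, Finsupp.linearCombination_apply, map_finsuppSum]
  have h : ∀ i, columnWeight p D i = syndromeCoords B H (symbolWeight n q α i) := fun i => by
    ext k
    have hk : (D k i : ZMod p) = extendedMatrix q α B H k i := congrFun (congrFun hD k) i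
    change (D k i : ZMod p) = B.repr (H.mulVec (Pi.single i.1 (α ^ (i.2.val + 1))) k.1) k.2
    rw [hk, Matrix.mulVec_single]
    simp [extendedMatrix, mul_comm]
  simp only [map_nsmul, h]

end ParityCheck

end

/-! ### The Graver basis of the code ideals -/

theorem mainTheorem1 {K F : Type*} [Field K] [Field F] [Fintype F]
    {p r q n m : ℕ} [Fact p.Prime] [Algebra (ZMod p) F]
    (hq : Fintype.card F = q)
    (B : Module.Basis (Fin r) (ZMod p) F)
    (α : F) (hα : IsPrimitiveRoot α (q - 1))
    (C : Submodule F (Fin n → F))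
    (H : Matrix (Fin m) (Fin n) F)
    (hH : ∀ c : Fin n → F, c ∈ C ↔ Matrix.vecMul c H.transpose = 0)
    (D : Matrix (Fin m × Fin r) (Fin n × Fin (q - 1)) ℤ)
    (hD : D.map (Int.cast : ℤ → ZMod p) = extendedMatrix q α B H)
    (ord : MonomialOrder ((Fin n × Fin (q - 1)) ⊕ (Fin n × Fin (q - 1))))
    (G : Set (MvPolynomial ((Fin n × Fin (q - 1)) ⊕ (Fin n × Fin (q - 1))) K))
    (hG : IsReducedGroebnerBasis ord (lawrenceIdeal K p D) G) :
    ((∀ j : Fin n, ∃ c ∈ C, c j ≠ 0) →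
      graverBasis (genCodeIdeal K q α C) = {f | f ∈ uncross G ∨ -f ∈ uncross G}) ∧
    graverBasis (genCodeIdeal K q α C ⊔ additiveIdeal K n q α) =
      {f | f ∈ uncross G ∨ -f ∈ uncross G} ∧
    (∀ f ∈ uncross G, -f ∈ uncross G → -f = f) := by
  have hJ := isWeightIdeal_lawrenceIdeal (K := K) p D
  have hI : ∀ u v : Fin n × Fin (q - 1) →₀ ℕ,
      monoDiff K u v ∈ genCodeIdeal K q α C ⊔ additiveIdeal K n q α ↔
        Finsupp.linearCombination ℕ (columnWeight p D) u =
          Finsupp.linearCombination ℕ (columnWeight p D) v := fun u v => by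
    rw [(isWeightIdeal_sup hq hα C).monoDiff_mem_iff, linearCombination_codeWeight_eq_iff,
      linearCombination_columnWeight_eq_syndromeCoords B H hD,
      linearCombination_columnWeight_eq_syndromeCoords B H hD, syndromeCoords_eq_iff, hH]
  refine ⟨fun hC => ?_, graverBasis_eq hI hJ hG,
    fun f hf hf' => neg_eq_self_of_mem_uncross hG hf hf'⟩
  rw [← sup_eq_left.mpr (additiveIdeal_le_genCodeIdeal (K := K) hα hC)]
  exact graverBasis_eq hI hJ hG
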